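/- **Conventions.** A *pointed fibration* is a Serre fibration $p\colon E\to B$ (a continuous map with the homotopy lifting property for all cubes; every Hurewicz fibration is one) with base points $e_0\in E$ and $b_0=p(e_0)\in B$, whose fiber $F=p^{-1}(b_0)$ is pointed by $e_0$, and such that $B$, $E$ and $F$ are path connected. A *section* of $p$ is a continuous map $\sigma\colon B\to E$ with $p\circ\sigma=\mathrm{id}_B$ and $\sigma(b_0)=e_0$. A *homotopically trivial fibration* $(p,r_p)$ is a pointed fibration $p$ together with maps $r_p\colon\pi_i(E)\to\pi_i(F)$, for all $i$, such that $r_p\circ\iota_*=\mathrm{id}$ on $\pi_i(F)$, where $\iota\colon F\to E$ is the inclusion (so $\iota_*$ is injective; $r_p$ need not be a homomorphism). For such a fibration that admits a section and $\alpha\in\pi_i(B)$, the *Berstein–Hilton invariant* is $$H(\alpha,r_p)=\{\,r_p(\sigma_*(\alpha)) : \sigma \text{ a section of } p\,\}\subset\pi_i(F).$$ A homotopically trivial fibration $(p',r_{p'})\colon E'\to B'$ with fiber $F'$ is a *homotopically trivial subfibration* of $(p,r_p)\colon E\to B$ if it is equipped with continuous maps $f_E\colon E'\to E$ and $f_B\colon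 B'\to B$ such that $p\circ f_E=f_B\circ p'$, $f_E$ preserves base points, $f_E$, $f_B$ and the restriction $f_F\colon F'\to F$ of $f_E$ are topological embeddings, and $r_p\circ(f_E)_*=(f_F)_*\circ r_{p'}\colon\pi_i(E')\to\pi_i(F)$ for all $i$. **Theorem.** Let $(p',r_{p'})\colon E'\to B'$ be a homotopically trivial subfibration of a homotopically trivial fibration $(p,r_p)\colon E\to B$. Suppose that $B=B'\cup_\phi D$ is obtained from $B'$ by attaching an $(n+1)$-cell $D$, $n\ge 0$, along a pointed map $\phi\colon S^n\to B'$ representing $\alpha\in\pi_n(B')$, the inclusion $B'\to B$ being $f_B$. Suppose that $p'$ admits a section and that $H(\alpha,r_{p'})$ contains $0$ (the neutral element of $\pi_n(F')$, i.e. the class of the constant map). Then $p$ admits a section. -/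

import Mathlib

open CategoryTheory
open scoped unitInterval Topology Topology.Homotopy

universe u

noncomputable section

/-- A Serre fibration: the homotopy lifting property with respect to all cubes. -/
def IsSerreFibration {E B : Type*} [TopologicalSpace E] [TopologicalSpace B] (p : C(E, B)) :
    Prop :=
  ∀ (k : ℕ) (H : C((Fin k → I) × I, B)) (g : C(Fin k → I, E)),
    (∀ x, p (g x) = H (x, 0)) →
      ∃ G : C((Fin k → I) × I, E), (∀ x, G (x, 0) = g x) ∧ ∀ z, p (G z) = H z

/-- The map `f_* : π_n(X, x) → π_n(Y, y)` induced by a continuous map `f` with `f x = y`. -/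
def piMap (n : ℕ) {X Y : Type*} [TopologicalSpace X] [TopologicalSpace Y] {x : X} {y : Y}
    (f : C(X, Y)) (h : f x = y) : π_ n X x → π_ n Y y :=
  Quotient.map (fun a => ⟨f.comp a.1, fun t ht => (congrArg f (a.2 t ht)).trans h⟩)
    (fun _ _ hab => ContinuousMap.HomotopicRel.comp_continuousMap hab f)

/-- The neutral element of `π_n(X, x)`: the class of the constant map. -/
def piZero (n : ℕ) {X : Type*} [TopologicalSpace X] (x : X) : π_ n X x :=
  Quotient.mk _ GenLoop.const

/-- A pointed fibration `p : E → B`. The base point of `B` is the image of that of `E`, the fibre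
is taken over it and is pointed by the base point of `E`. Base, total space and fibre are
path connected. -/
structure PointedFibration (E B : Type*) [TopologicalSpace E] [TopologicalSpace B] where
  proj : C(E, B)
  pt : E
  isSerreFibration : IsSerreFibration proj
  pathConnected_total : PathConnectedSpace E
  pathConnected_base : PathConnectedSpace B
  pathConnected_fiber : PathConnectedSpace {x : E // proj x = proj pt}

namespace PointedFibration

variable {E B : Type*} [TopologicalSpace E] [TopologicalSpace B]

/-- The base point of the base. -/
def basePt (P : PointedFibration E B) : B := P.proj P.pt

/-- The fibre over the base point. -/
abbrev Fiber (P : PointedFibration E B) : Type _ := {x : E // P.proj x = P.proj P.pt}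

/-- The base point of the fibre. -/
def fiberPt (P : PointedFibration E B) : P.Fiber := ⟨P.pt, rfl⟩

/-- The inclusion of the fibre into the total space. -/
def incl (P : PointedFibration E B) : C(P.Fiber, E) := ⟨Subtype.val, continuous_subtype_val⟩

/-- A pointed section. -/
structure PointedSection (P : PointedFibration E B) where
  toMap : C(B, E)
  proj_toMap : ∀ b, P.proj (toMap b) = b
  map_basePt : toMap P.basePt = P.pt

/-- A homotopically trivial structure on a pointed fibration: for every `i`, a retraction
`r_p : π_i(E) → π_i(F)` of the map `π_i(F) → π_i(E)` induced by the inclusion (which is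
therefore injective). The retraction is not required to be a homomorphism: for a fibration with a
section `σ` the retraction `γ ↦ γ - σ_* p_* γ` need not be one when `i = 1`. -/
structure HomotopicallyTrivial (P : PointedFibration E B) where
  retr : ∀ i : ℕ, π_ i E P.pt → π_ i P.Fiber P.fiberPt
  retr_incl : ∀ (i : ℕ) (y : π_ i P.Fiber P.fiberPt),
    retr i (piMap i P.incl (x := P.fiberPt) (y := P.pt) rfl y) = y

/-- The Berstein-Hilton invariant `H(α, r_p)`: the set of all `r_p (s_* α)`, where `s` ranges over
the pointed sections. -/
def bersteinHilton {P : PointedFibration E B} (r : P.HomotopicallyTrivial) {i : ℕ}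
    (α : π_ i B P.basePt) : Set (π_ i P.Fiber P.fiberPt) :=
  {γ | ∃ s : P.PointedSection, r.retr i (piMap i s.toMap s.map_basePt α) = γ}

variable {E' B' : Type*} [TopologicalSpace E'] [TopologicalSpace B']

/-- A (pointed) map of fibrations. -/
structure Hom (P' : PointedFibration E' B') (P : PointedFibration E B) where
  total : C(E', E)
  base : C(B', B)
  comm : ∀ x, P.proj (total x) = base (P'.proj x)
  map_pt : total P'.pt = P.pt

/-- The component of a map of fibrations on the fibres. -/
def Hom.fiber {P' : PointedFibration E' B'} {P : PointedFibration E B} (f : P'.Hom P) :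
    C(P'.Fiber, P.Fiber) where
  toFun x := ⟨f.total x.1, by rw [f.comm, x.2, ← f.comm, f.map_pt]⟩
  continuous_toFun := by fun_prop

theorem Hom.fiber_fiberPt {P' : PointedFibration E' B'} {P : PointedFibration E B}
    (f : P'.Hom P) : f.fiber P'.fiberPt = P.fiberPt :=
  Subtype.ext f.map_pt

/-- A map of fibrations is a morphism of homotopically trivial fibrations if it commutes with the
retractions. -/
def Hom.IsMorphism {P' : PointedFibration E' B'} {P : PointedFibration E B} (f : P'.Hom P)
    (r' : P'.HomotopicallyTrivial) (r : P.HomotopicallyTrivial) : Prop :=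
  ∀ (i : ℕ) (γ : π_ i E' P'.pt),
    r.retr i (piMap i f.total f.map_pt γ) = piMap i f.fiber f.fiber_fiberPt (r'.retr i γ)

/-- `f` exhibits `(P', r')` as a homotopically trivial subfibration of `(P, r)`: it is a morphism
all of whose components are embeddings. -/
structure Hom.IsSubfibration {P' : PointedFibration E' B'} {P : PointedFibration E B}
    (f : P'.Hom P) (r' : P'.HomotopicallyTrivial) (r : P.HomotopicallyTrivial) : Prop where
  isMorphism : f.IsMorphism r' r
  total : Topology.IsEmbedding f.total
  base : Topology.IsEmbedding f.base
  fiber : Topology.IsEmbedding f.fiber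

end PointedFibration

/-- `q : I^n → S^n` induces a homeomorphism from `I^n / ∂I^n` (for `n = 0`: a point with a disjoint
base point) onto `S^n`, the base point going to `s`. -/
structure IsSphereCollapse {n : ℕ} (q : C(Fin n → I, TopCat.diskBoundary.{u} (n + 1)))
    (s : TopCat.diskBoundary.{u} (n + 1)) : Prop where
  boundary : ∀ y ∈ Cube.boundary (Fin n), q y = s
  bijOn : Set.BijOn q (Cube.boundary (Fin n))ᶜ {s}ᶜ

/-- `φ : S^n → X` is a pointed map representing `α ∈ π_n(X, x)`, for some identification of
`I^n / ∂I^n` with `S^n`. -/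
def RepresentsClass {n : ℕ} {X : Type u} [TopologicalSpace X] {x : X}
    (φ : C(TopCat.diskBoundary.{u} (n + 1), X)) (α : π_ n X x) : Prop :=
  ∃ (s : TopCat.diskBoundary.{u} (n + 1)) (q : C(Fin n → I, TopCat.diskBoundary.{u} (n + 1)))
    (hq : IsSphereCollapse q s) (hs : φ s = x),
    piMap n φ hs (Quotient.mk _ (⟨q, hq.boundary⟩ : GenLoop (Fin n) _ s)) = α

/-- `B = B' ∪_φ D` for a cell `D` of dimension `n + 1` attached along `φ : S^n → B'`, with `j` the
inclusion of `B'`: for some characteristic map `D → B` the square is a pushout of topological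
spaces. -/
def IsCellAttachment {n : ℕ} {B' B : Type u} [TopologicalSpace B'] [TopologicalSpace B]
    (φ : C(TopCat.diskBoundary.{u} (n + 1), B')) (j : C(B', B)) : Prop :=
  ∃ Φ : C(TopCat.disk.{u} (n + 1), B),
    IsPushout (TopCat.diskBoundaryInclusion.{u} (n + 1))
      (TopCat.ofHom φ : TopCat.diskBoundary.{u} (n + 1) ⟶ TopCat.of B')
      (TopCat.ofHom Φ : TopCat.disk.{u} (n + 1) ⟶ TopCat.of B)
      (TopCat.ofHom j : TopCat.of B' ⟶ TopCat.of B)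

end

/-! Let `w` be a section of `p'` whose class `w_* α` is killed by `r'`. Its composite `τ` with `E' →
E` is a section of `p` over `B'`, and it remains to extend `τ` over the cell: the characteristic map
must lift to `E` with prescribed boundary values `τ ∘ φ`. View the disk as a quotient of `I^n × I`
by joining each boundary point to the base point `s` by a segment (`coneMap`). The characteristic
map becomes a null-homotopy `K` of `p ∘ g`, where `g = τ ∘ φ ∘ q`, and the lift becomes a
null-homotopy of `g` lying exactly over `K` (`exists_lift_nullHomotopy`). Lifting `K` relative to
the boundary deforms `g` to a loop `γ` in the fibre. Since `r` is a retraction, `[γ] = r [g]`, which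
is `0` by compatibility with `r'`; so `γ` contracts in the fibre. The concatenated homotopy covers
`K` only up to reparametrization, which a second relative lifting (`lift_rel_boundary_prod`)
corrects. -/

noncomputable section

/-! ### Retracting a cylinder over a cube onto its bottom and sides -/

/-- The point of `I` nearest to `x` at distance at most `u` from `a`. -/
def unitInterval.clamp (a x u : I) : I :=
  Set.projIcc (0 : ℝ) 1 zero_le_one (max (a - u : ℝ) (min (a + u) x))

theorem unitInterval.continuous_clamp :
    Continuous fun z : I × I × I => unitInterval.clamp z.1 z.2.1 z.2.2 := by
  unfold unitInterval.clamp
  exact continuous_projIcc.comp (by fun_prop)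

theorem unitInterval.clamp_zero (a x : I) : unitInterval.clamp a x 0 = a := by
  have : max (a - ((0 : I) : ℝ)) (min (a + ((0 : I) : ℝ)) x) = a := by simp
  rw [unitInterval.clamp, this, Set.projIcc_val]

theorem unitInterval.clamp_of_dist_le {a x u : I} (h : dist x a ≤ u) :
    unitInterval.clamp a x u = x := by
  rw [Subtype.dist_eq, Real.dist_eq, abs_le] at h
  have : max (a - u : ℝ) (min (a + u) x) = x := by
    rw [min_eq_right (by linarith), max_eq_right (by linarith)]
  rw [unitInterval.clamp, this, Set.projIcc_val]

section CubeRetraction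

variable {k : ℕ}

/-- The cube `I^k` in coordinates centred at its midpoint, with values in `[-1, 1]^k`. -/
def Cube.center (y : Fin k → I) : Fin k → ℝ := fun i => 2 * (y i : ℝ) - 1

theorem Cube.norm_center_le_one (y : Fin k → I) : ‖Cube.center y‖ ≤ 1 := by
  refine (pi_norm_le_iff_of_nonneg zero_le_one).2 fun i => ?_
  have h0 := (y i).2.1
  have h1 := (y i).2.2
  rw [Real.norm_eq_abs, abs_le]
  constructor <;> simp only [Cube.center] <;> linarith

theorem Cube.norm_center_of_mem_boundary {y : Fin k → I} (hy : y ∈ Cube.boundary (Fin k)) :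
    ‖Cube.center y‖ = 1 := by
  obtain ⟨i, hi⟩ := hy
  refine le_antisymm (Cube.norm_center_le_one y) ?_
  refine le_trans (le_of_eq ?_) (norm_le_pi_norm (Cube.center y) i)
  rcases hi with hi | hi <;> simp [Cube.center, hi]
  norm_num

theorem Cube.exists_abs_center_of_norm {v : Fin k → ℝ} (hv : 0 < ‖v‖) : ∃ i, |v i| = ‖v‖ := by
  have : Nonempty (Fin k) := by
    by_contra h
    rw [not_nonempty_iff] at h
    simp [Subsingleton.elim v 0] at hv
  obtain ⟨i, -, hi⟩ := Finset.exists_mem_eq_sup' (Finset.univ_nonempty (α := Fin k)) (fun i => ‖v i‖)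
  refine ⟨i, le_antisymm (norm_le_pi_norm v i) ?_⟩
  refine (pi_norm_le_iff_of_nonneg (abs_nonneg _)).2 fun j => ?_
  rw [← Real.norm_eq_abs, ← hi]
  exact Finset.le_sup' (fun i => ‖v i‖) (Finset.mem_univ j)

/-- The scaling factor of the projection of `I^k × I` from a point above the cube. -/
def Cube.scale (z : (Fin k → I) × I) : ℝ := max ‖Cube.center z.1‖ (1 - (z.2 : ℝ) / 2)

theorem Cube.scale_pos (z : (Fin k → I) × I) : 0 < Cube.scale z :=
  lt_max_of_lt_right (by linarith [z.2.2.2])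

theorem Cube.continuous_scale : Continuous (Cube.scale (k := k)) := by
  unfold Cube.scale Cube.center
  fun_prop

/-- The retraction of `I^k × I` onto `I^k × {0} ∪ ∂I^k × I` by projection from a point above the
cube. -/
def Cube.retract (z : (Fin k → I) × I) : (Fin k → I) × I :=
  (fun i => Set.projIcc (0 : ℝ) 1 zero_le_one ((Cube.center z.1 i / Cube.scale z + 1) / 2),
    Set.projIcc (0 : ℝ) 1 zero_le_one (2 - (2 - z.2) / Cube.scale z))

theorem Cube.continuous_retract : Continuous (Cube.retract (k := k)) := by
  have hs := Cube.continuous_scale (k := k)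
  have h0 : ∀ z : (Fin k → I) × I, Cube.scale z ≠ 0 := fun z => (Cube.scale_pos z).ne'
  refine Continuous.prodMk (continuous_pi fun i => continuous_projIcc.comp ?_)
    (continuous_projIcc.comp ?_)
  · have : Continuous fun z : (Fin k → I) × I => Cube.center z.1 i := by
      unfold Cube.center; fun_prop
    exact ((this.div hs h0).add continuous_const).div_const _
  · exact continuous_const.sub ((by fun_prop : Continuous fun z : (Fin k → I) × I =>
      (2 - z.2 : ℝ)).div hs h0)

theorem Cube.retract_of_scale_eq_one {z : (Fin k → I) × I} (hz : Cube.scale z = 1) :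
    Cube.retract z = z := by
  refine Prod.ext (funext fun i => ?_) ?_
  · simp only [Cube.retract, hz, Cube.center]
    rw [show ((2 * (z.1 i : ℝ) - 1) / 1 + 1) / 2 = z.1 i by ring, Set.projIcc_val]
  · simp only [Cube.retract, hz]
    rw [show 2 - (2 - (z.2 : ℝ)) / 1 = z.2 by ring, Set.projIcc_val]

theorem Cube.retract_zero (y : Fin k → I) : Cube.retract (y, 0) = (y, 0) :=
  Cube.retract_of_scale_eq_one <| by
    simpa [Cube.scale] using Cube.norm_center_le_one y

theorem Cube.retract_of_mem_boundary {y : Fin k → I} (hy : y ∈ Cube.boundary (Fin k)) (t : I) :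
    Cube.retract (y, t) = (y, t) :=
  Cube.retract_of_scale_eq_one <| by
    have := t.2.1
    rw [Cube.scale, Cube.norm_center_of_mem_boundary hy, max_eq_left]
    simp only
    linarith

/-- The projection centre lies over the midpoint at height `2`. The ray through `z` reaches the
sides when the scale is the sup norm, and the bottom when it is `1 - t/2`; the larger scale is the
first hit. -/
theorem Cube.retract_mem (z : (Fin k → I) × I) :
    (Cube.retract z).2 = 0 ∨ (Cube.retract z).1 ∈ Cube.boundary (Fin k) := by
  have hm := Cube.scale_pos z
  rcases max_choice ‖Cube.center z.1‖ (1 - (z.2 : ℝ) / 2) with h | h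
  · right
    change Cube.scale z = _ at h
    obtain ⟨i, hi⟩ := Cube.exists_abs_center_of_norm (h ▸ hm)
    rw [← h] at hi
    refine ⟨i, ?_⟩
    simp only [Cube.retract]
    rcases abs_choice (Cube.center z.1 i) with h' | h'
    · right
      rw [← h', hi, div_self hm.ne']
      exact Set.projIcc_of_right_le _ (by norm_num)
    · left
      rw [← neg_neg (Cube.center z.1 i), ← h', hi, neg_div, div_self hm.ne']
      exact Set.projIcc_of_le_left _ (by norm_num)
  · left
    change Cube.scale z = _ at h
    simp only [Cube.retract]
    refine Set.projIcc_of_le_left _ (le_of_eq ?_)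
    rw [sub_eq_zero, eq_div_iff hm.ne', h]
    ring

end CubeRetraction

/-- The cube `I^k × I` is homeomorphic to `I^(k+1)`. -/
def Cube.prodHomeomorph (k : ℕ) : (Fin k → I) × I ≃ₜ (Fin (k + 1) → I) where
  toFun z := Fin.snoc (α := fun _ => I) z.1 z.2
  invFun w := (Fin.init (α := fun _ => I) w, w (Fin.last k))
  left_inv z := by simp
  right_inv w := by simp
  continuous_toFun := Continuous.finSnoc (A := fun _ => I) continuous_fst continuous_snd
  continuous_invFun := (Continuous.finInit (A := fun _ => I) continuous_id).prodMk (continuous_apply _)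

theorem Cube.prodHomeomorph_mem_boundary {k : ℕ} {z : (Fin k → I) × I} :
    Cube.prodHomeomorph k z ∈ Cube.boundary (Fin (k + 1)) ↔
      z.1 ∈ Cube.boundary (Fin k) ∨ z.2 = 0 ∨ z.2 = 1 := by
  change (∃ i, Fin.snoc (α := fun _ => I) z.1 z.2 i = 0 ∨
    Fin.snoc (α := fun _ => I) z.1 z.2 i = 1) ↔ _
  rw [Fin.exists_fin_succ']
  simp only [Fin.snoc_castSucc, Fin.snoc_last]
  rfl

/-! ### Relative homotopy lifting -/

section Lifting

variable {E B X : Type*} [TopologicalSpace E] [TopologicalSpace B] [TopologicalSpace X]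
  {p : C(E, B)} {k : ℕ}

theorem IsSerreFibration.lift_homeomorph (hp : IsSerreFibration p) (e : X ≃ₜ (Fin k → I))
    (H : C(X × I, B)) (g : C(X, E)) (h : ∀ x, p (g x) = H (x, 0)) :
    ∃ G : C(X × I, E), (∀ x, G (x, 0) = g x) ∧ ∀ z, p (G z) = H z := by
  obtain ⟨G, h0, h1⟩ := hp k
    (H.comp ⟨fun z => (e.symm z.1, z.2), by fun_prop⟩) (g.comp ⟨e.symm, e.symm.continuous⟩)
    (fun x => h _)
  refine ⟨G.comp ⟨fun z => (e z.1, z.2), by fun_prop⟩, fun x => ?_, fun z => ?_⟩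
  · simpa using h0 (e x)
  · simpa using h1 (e z.1, z.2)

/-- A Serre fibration lifts homotopies of cubes that are stationary on the boundary to homotopies
that are stationary on the boundary. -/
theorem IsSerreFibration.lift_rel_boundary (hp : IsSerreFibration p)
    (H : C((Fin k → I) × I, B)) (g : C(Fin k → I, E)) (h : ∀ y, p (g y) = H (y, 0))
    (hb : ∀ y ∈ Cube.boundary (Fin k), ∀ t, H (y, t) = H (y, 0)) :
    ∃ G : C((Fin k → I) × I, E), (∀ y, G (y, 0) = g y) ∧ (∀ z, p (G z) = H z) ∧
      ∀ y ∈ Cube.boundary (Fin k), ∀ t, G (y, t) = g y := by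
  have hr := Cube.continuous_retract (k := k)
  let D : ((Fin k → I) × I) × I → (Fin k → I) × I := fun w =>
    (fun i => unitInterval.clamp ((Cube.retract w.1).1 i) (w.1.1 i) w.2,
      unitInterval.clamp (Cube.retract w.1).2 w.1.2 w.2)
  have hD : Continuous D := by
    refine Continuous.prodMk (continuous_pi fun i => ?_) ?_
    · exact unitInterval.continuous_clamp.comp (f := fun w : ((Fin k → I) × I) × I =>
        ((Cube.retract w.1).1 i, w.1.1 i, w.2))
        (((continuous_apply i).comp (hr.fst.comp continuous_fst)).prodMk (by fun_prop))
    · exact unitInterval.continuous_clamp.comp (f := fun w : ((Fin k → I) × I) × I =>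
        ((Cube.retract w.1).2, w.1.2, w.2))
        ((hr.snd.comp continuous_fst).prodMk (by fun_prop))
  have hD0 : ∀ z, D (z, 0) = Cube.retract z := fun z =>
    Prod.ext (funext fun i => unitInterval.clamp_zero _ _) (unitInterval.clamp_zero _ _)
  have hdist : ∀ z : (Fin k → I) × I, dist z (Cube.retract z) ≤ 1 := fun z => by
    have hI : ∀ a b : I, dist a b ≤ 1 := fun a b => by
      rw [Subtype.dist_eq, Real.dist_eq, abs_le]
      constructor <;> linarith [a.2.1, a.2.2, b.2.1, b.2.2]
    exact max_le ((dist_pi_le_iff zero_le_one).2 fun i => hI _ _) (hI _ _)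
  -- Time enough for `D` to travel from the retraction of `z` to `z`. It vanishes where the
  -- retraction is the identity, so evaluating the lift at time `ζ z` keeps the values on bottom and
  -- sides exact.
  let ζ : (Fin k → I) × I → I := fun z => ⟨dist z (Cube.retract z), dist_nonneg, hdist z⟩
  have hζ : Continuous ζ := Continuous.subtype_mk (continuous_id.dist hr) _
  have hDζ : ∀ z, D (z, ζ z) = z := fun z =>
    Prod.ext (funext fun i => unitInterval.clamp_of_dist_le
      ((dist_le_pi_dist z.1 _ i).trans (le_max_left _ _)))
      (unitInterval.clamp_of_dist_le (le_max_right _ _))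
  obtain ⟨G, hG0, hG1⟩ := hp.lift_homeomorph (Cube.prodHomeomorph k) (H.comp ⟨D, hD⟩)
    (g.comp ⟨fun z => (Cube.retract z).1, hr.fst⟩) (fun z => by
      simp only [ContinuousMap.comp_apply, ContinuousMap.coe_mk, hD0, h]
      rcases Cube.retract_mem z with hz | hz
      · rw [← hz]
      · exact (hb _ hz _).symm)
  have hfix : ∀ z, Cube.retract z = z → G (z, ζ z) = g z.1 := fun z hz => by
    have : ζ z = 0 := Subtype.ext (by simp [ζ, hz])
    rw [this, hG0]
    simp [hz]
  refine ⟨G.comp ⟨fun z => (z, ζ z), by fun_prop⟩, fun y => ?_, fun z => ?_, fun y hy t => ?_⟩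
  · exact hfix _ (Cube.retract_zero y)
  · simp [hG1, hDζ]
  · exact hfix _ (Cube.retract_of_mem_boundary hy t)

/-- A Serre fibration lifts homotopies of `I^k × I` that are stationary on the boundary to
homotopies that are stationary on the boundary. -/
theorem IsSerreFibration.lift_rel_boundary_prod (hp : IsSerreFibration p)
    (H : C(((Fin k → I) × I) × I, B)) (g : C((Fin k → I) × I, E)) (h : ∀ z, p (g z) = H (z, 0))
    (hb : ∀ z : (Fin k → I) × I, z.1 ∈ Cube.boundary (Fin k) ∨ z.2 = 0 ∨ z.2 = 1 →
      ∀ t, H (z, t) = H (z, 0)) :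
    ∃ G : C((Fin k → I) × I, E), (∀ z, p (G z) = H (z, 1)) ∧
      ∀ z : (Fin k → I) × I, z.1 ∈ Cube.boundary (Fin k) ∨ z.2 = 0 ∨ z.2 = 1 → G z = g z := by
  let e := Cube.prodHomeomorph k
  obtain ⟨G, -, h1, h2⟩ := hp.lift_rel_boundary
    (H.comp ⟨fun z => (e.symm z.1, z.2), by fun_prop⟩) (g.comp ⟨e.symm, e.symm.continuous⟩)
    (fun x => h _) (fun y hy t => by
      refine hb (e.symm y) (Cube.prodHomeomorph_mem_boundary.1 ?_) t
      rwa [show Cube.prodHomeomorph k (e.symm y) = y from e.apply_symm_apply y])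
  refine ⟨G.comp ⟨fun z => (e z, 1), by fun_prop⟩, fun z => ?_, fun z hz => ?_⟩
  · simpa using h1 (e z, 1)
  · simpa using h2 (e z) (Cube.prodHomeomorph_mem_boundary.2 hz) 1

end Lifting

/-! ### Contracting a loop over a given null-homotopy -/

namespace PointedFibration

variable {E B : Type*} [TopologicalSpace E] [TopologicalSpace B]

/-- Over a null-homotopy in the base, a loop in the total space that is homotopic into the fibre
and has trivial retraction can be contracted. -/
theorem HomotopicallyTrivial.exists_lift_nullHomotopy {P : PointedFibration E B}
    (r : P.HomotopicallyTrivial) {n : ℕ} (g : GenLoop (Fin n) E P.pt)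
    (hg : r.retr n (Quotient.mk _ g) = piZero n P.fiberPt) (K : C((Fin n → I) × I, B))
    (h0 : ∀ y, P.proj (g y) = K (y, 0))
    (hb : ∀ y ∈ Cube.boundary (Fin n), ∀ t, K (y, t) = P.proj P.pt)
    (h1 : ∀ y, K (y, 1) = P.proj P.pt) :
    ∃ W : C((Fin n → I) × I, E), (∀ z, P.proj (W z) = K z) ∧ (∀ y, W (y, 0) = g y) ∧
      (∀ y ∈ Cube.boundary (Fin n), ∀ t, W (y, t) = P.pt) ∧ ∀ y, W (y, 1) = P.pt := by
  obtain ⟨G, hG0, hG1, hG2⟩ := P.isSerreFibration.lift_rel_boundary K g.1 h0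
    (fun y hy t => by rw [hb y hy, hb y hy])
  have hGb : ∀ y ∈ Cube.boundary (Fin n), ∀ t, G (y, t) = P.pt := fun y hy t =>
    (hG2 y hy t).trans (g.2 y hy)
  -- the end of the lifted homotopy is a loop in the fibre
  let γ : GenLoop (Fin n) P.Fiber P.fiberPt :=
    ⟨⟨fun y => ⟨G (y, 1), by rw [hG1, h1]⟩, by fun_prop⟩, fun y hy => Subtype.ext (hGb y hy 1)⟩
  let F₁ : g.1.HomotopyRel (P.incl.comp γ.1) (Cube.boundary (Fin n)) :=
    { toFun := fun z => G (z.2, z.1)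
      continuous_toFun := by fun_prop
      map_zero_left := hG0
      map_one_left := fun y => rfl
      prop' := fun t y hy => hG2 y hy t }
  -- `[γ] = r (ι_* [γ]) = r [g] = 0`; additivity of `r` plays no role.
  have hγ : (Quotient.mk _ γ : π_ n P.Fiber P.fiberPt) = piZero n P.fiberPt :=
    ((r.retr_incl n (Quotient.mk _ γ)).symm.trans
      (congrArg (r.retr n) (Quotient.sound ⟨F₁.symm⟩))).trans hg
  obtain ⟨L⟩ : GenLoop.Homotopic γ GenLoop.const := Quotient.exact hγ
  let M := F₁.trans (L.compContinuousMap P.incl)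
  -- Speed `2 - u`, stopped at `1`: `κ 0` is the double-speed-then-rest clock of the concatenation
  -- `M`, `κ 1` is the identity, and all `κ u` fix both endpoints, so the homotopy of `K` is
  -- stationary on the boundary.
  let κ : I → I → I := fun u t =>
    Set.projIcc (0 : ℝ) 1 zero_le_one ((2 - u) * t)
  have hκ : Continuous fun z : I × I => κ z.1 z.2 := continuous_projIcc.comp (by fun_prop)
  have hκ0 : ∀ u, κ u 0 = 0 := fun u => Set.projIcc_of_le_left _ (by simp)
  have hκ1 : ∀ u, κ u 1 = 1 := fun u =>
    Set.projIcc_of_right_le _ (by simp only [Set.Icc.coe_one]; linarith [u.2.2])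
  have hκ' : ∀ t, κ 1 t = t := fun t => by
    have : (2 - ((1 : I) : ℝ)) * t = t := by simp only [Set.Icc.coe_one]; ring
    simp only [κ, this, Set.projIcc_val]
  have hM : ∀ y t, P.proj (M (t, y)) = K (y, κ 0 t) := by
    intro y t
    rw [ContinuousMap.HomotopyRel.trans_apply]
    split_ifs with h
    · refine (hG1 _).trans (congrArg (fun s => K (y, s)) ?_)
      refine Subtype.ext ?_
      have h0 := t.2.1
      simp only [one_div] at h
      simp only [κ, Set.Icc.coe_zero, sub_zero]
      rw [Set.projIcc_of_mem zero_le_one ⟨by linarith, by linarith⟩]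
    · refine (L _).2.trans ?_
      rw [show κ 0 t = 1 from Set.projIcc_of_right_le _ (by
        simp only [Set.Icc.coe_zero, sub_zero]; linarith), h1]
  obtain ⟨W, hW, hWb⟩ := P.isSerreFibration.lift_rel_boundary_prod
    (K.comp ⟨fun w : ((Fin n → I) × I) × I => (w.1.1, κ w.2 w.1.2), by fun_prop⟩)
    ⟨fun z => M (z.2, z.1), by fun_prop⟩ (fun z => hM z.1 z.2) (by
      rintro ⟨y, t⟩ (hy | rfl | rfl) u
      · exact (hb y hy _).trans (hb y hy _).symm
      · simp [hκ0]
      · simp [hκ1])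
  refine ⟨W, fun z => ?_, fun y => ?_, fun y hy t => ?_, fun y => ?_⟩
  · simpa [hκ'] using hW z
  · exact (hWb (y, 0) (Or.inr (Or.inl rfl))).trans (M.map_zero_left y)
  · exact ((hWb (y, t) (Or.inl hy)).trans (M.eq_fst t hy)).trans (g.2 y hy)
  · exact (hWb (y, 1) (Or.inr (Or.inr rfl))).trans (M.map_one_left y)

end PointedFibration

/-! ### The disk as a quotient of the cylinder over a cube -/

section Chords

variable {V : Type*} [NormedAddCommGroup V] [InnerProductSpace ℝ V]

/-- The ray `s + l (d - s)` meets the sphere again at `l = -2⟪s, d - s⟫ / ‖d - s‖²`; `‖d‖ ≤ 1` gives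
`l ≥ 1`, hence `t = 1 - 1/l` lies in `I`. -/
theorem exists_chord {s d : V} (hs : ‖s‖ = 1) (hd : ‖d‖ ≤ 1) (hne : d ≠ s) :
    ∃ (x : V) (t : I), ‖x‖ = 1 ∧ x ≠ s ∧ (1 - t : ℝ) • x + (t : ℝ) • s = d := by
  have hv : 0 < ‖d - s‖ ^ 2 := by
    have := norm_pos_iff.2 (sub_ne_zero.2 hne)
    positivity
  have hexp : ∀ l : ℝ, ‖s + l • (d - s)‖ ^ 2 =
      1 + 2 * l * inner ℝ s (d - s) + l ^ 2 * ‖d - s‖ ^ 2 := fun l => by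
    rw [norm_add_sq_real, inner_smul_right, norm_smul, mul_pow, hs, Real.norm_eq_abs, sq_abs]
    ring
  have h1 := hexp 1
  rw [one_smul, add_sub_cancel] at h1
  have hd2 : ‖d‖ ^ 2 ≤ 1 := pow_le_one₀ (norm_nonneg _) hd
  set a : ℝ := inner ℝ s (d - s)
  set b : ℝ := ‖d - s‖ ^ 2
  have hl : 1 ≤ -2 * a / b := by
    rw [le_div_iff₀ hv]
    linarith
  have hl0 : -2 * a / b ≠ 0 := by positivity
  refine ⟨s + (-2 * a / b) • (d - s), ⟨1 - (-2 * a / b)⁻¹, ?_, ?_⟩, ?_, ?_, ?_⟩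
  · linarith [inv_le_one_of_one_le₀ hl]
  · linarith [inv_nonneg.2 (zero_le_one.trans hl)]
  · have := hexp (-2 * a / b)
    rw [← sq_eq_sq₀ (norm_nonneg _) zero_le_one, this]
    field_simp
    ring
  · rw [Ne, add_eq_left]
    exact smul_ne_zero hl0 (sub_ne_zero.2 hne)
  · simp only [sub_sub_cancel, smul_add, smul_smul, inv_mul_cancel₀ hl0, sub_smul, one_smul]
    abel

theorem chord_ne {s x : V} (hne : x ≠ s) {t : ℝ} (ht : t ≠ 1) : (1 - t) • x + t • s ≠ s := by
  intro h
  have : (1 - t) • (x - s) = 0 := by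
    rw [smul_sub, sub_smul 1 t s, one_smul, ← sub_eq_zero.2 h]
    abel
  rcases smul_eq_zero.1 this with h' | h'
  · exact ht (by linarith)
  · exact hne (sub_eq_zero.1 h')

/-- Here `x - s = m (x' - s)` with `m ≠ 0`, and a line through `s` meets the sphere in at most one
other point, so `m = 1`. -/
theorem chord_unique {s x x' : V} (hs : ‖s‖ = 1) (hx : ‖x‖ = 1) (hx' : ‖x'‖ = 1)
    (hne' : x' ≠ s) {t t' : ℝ} (ht : t ≠ 1) (ht' : t' ≠ 1)
    (h : (1 - t) • x + t • s = (1 - t') • x' + t' • s) : x = x' ∧ t = t' := by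
  have ha : 1 - t ≠ 0 := sub_ne_zero.2 ht.symm
  have ha' : 1 - t' ≠ 0 := sub_ne_zero.2 ht'.symm
  have hw' : x' - s ≠ 0 := sub_ne_zero.2 hne'
  have hw : x - s = ((1 - t)⁻¹ * (1 - t')) • (x' - s) := by
    rw [mul_smul, eq_inv_smul_iff₀ ha, ← sub_eq_zero]
    rw [← sub_eq_zero] at h
    rw [← h]
    module
  have key : ∀ y : V, ‖y‖ = 1 → 2 * inner ℝ s (y - s) + ‖y - s‖ ^ 2 = 0 := fun y hy => by
    have := norm_add_sq_real s (y - s)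
    rw [add_sub_cancel, hs, hy] at this
    linarith
  set m := (1 - t)⁻¹ * (1 - t') with hm
  have hm0 : m ≠ 0 := mul_ne_zero (inv_ne_zero ha) ha'
  have h1 := key x hx
  have h2 := key x' hx'
  rw [hw, inner_smul_right, norm_smul, mul_pow, Real.norm_eq_abs, sq_abs] at h1
  have hn : ‖x' - s‖ ^ 2 ≠ 0 := pow_ne_zero _ (norm_ne_zero_iff.2 hw')
  have h3 : m * (m - 1) * ‖x' - s‖ ^ 2 = 0 := by linear_combination h1 - m * h2
  have hm1 : m = 1 := by
    simpa [hm0, hw', sub_eq_zero] using h3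
  refine ⟨?_, ?_⟩
  · simpa [hm1] using hw
  · rw [hm1, eq_comm, inv_mul_eq_iff_eq_mul₀ ha] at hm
    linarith

end Chords

section Cone

variable {n : ℕ}

/-- The point at time `t` on the segment from `x` to `s` in the disk. -/
def diskChord (s x : TopCat.diskBoundary.{u} (n + 1)) (t : I) : TopCat.disk.{u} (n + 1) :=
  ⟨⟨(1 - t : ℝ) • x.down.1 + (t : ℝ) • s.down.1,
    (convex_closedBall _ _) (Metric.sphere_subset_closedBall x.down.2)
      (Metric.sphere_subset_closedBall s.down.2) (by linarith [t.2.2]) t.2.1 (by ring)⟩⟩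

theorem diskChord_zero (s x : TopCat.diskBoundary.{u} (n + 1)) :
    diskChord s x 0 = TopCat.diskBoundaryInclusion (n + 1) x :=
  ULift.ext _ _ (Subtype.ext (by simp [diskChord]; rfl))

theorem diskChord_one (s x : TopCat.diskBoundary.{u} (n + 1)) :
    diskChord s x 1 = TopCat.diskBoundaryInclusion (n + 1) s :=
  ULift.ext _ _ (Subtype.ext (by simp [diskChord]; rfl))

theorem diskChord_self (s : TopCat.diskBoundary.{u} (n + 1)) (t : I) :
    diskChord s s t = TopCat.diskBoundaryInclusion (n + 1) s :=
  ULift.ext _ _ (Subtype.ext (by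
    simp only [diskChord, ← add_smul, sub_add_cancel, one_smul]; rfl))

/-- The map from the cylinder on the cube to the disk that joins the points of the boundary sphere
to its base point. -/
def coneMap (q : C(Fin n → I, TopCat.diskBoundary.{u} (n + 1)))
    (s : TopCat.diskBoundary.{u} (n + 1)) : C((Fin n → I) × I, TopCat.disk.{u} (n + 1)) where
  toFun z := diskChord s (q z.1) z.2
  continuous_toFun := by
    have hq : Continuous fun z : (Fin n → I) × I => (q z.1).down.1 :=
      continuous_subtype_val.comp (continuous_uliftDown.comp (q.continuous.comp continuous_fst))
    refine continuous_uliftUp.comp (Continuous.subtype_mk ?_ _)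
    fun_prop

variable {q : C(Fin n → I, TopCat.diskBoundary.{u} (n + 1))}
  {s : TopCat.diskBoundary.{u} (n + 1)}

theorem IsSphereCollapse.mem_boundary_of_eq (hq : IsSphereCollapse q s) {y : Fin n → I}
    (hy : q y = s) : y ∈ Cube.boundary (Fin n) := by
  by_contra h
  exact hq.bijOn.mapsTo h hy

theorem IsSphereCollapse.surjective_coneMap (hq : IsSphereCollapse q s) :
    Function.Surjective (coneMap q s) := by
  have key : ∀ x : TopCat.diskBoundary.{u} (n + 1), x ≠ s → ∃ y, q y = x := fun x hx =>
    (hq.bijOn.surjOn hx).imp fun y hy => hy.2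
  have hs : ‖s.down.1‖ = 1 := mem_sphere_zero_iff_norm.1 s.down.2
  intro d
  have hd : ‖d.down.1‖ ≤ 1 := mem_closedBall_zero_iff.1 d.down.2
  by_cases hds : d.down.1 = s.down.1
  · refine ⟨(fun _ => 0, 1), (diskChord_one _ _).trans ?_⟩
    exact ULift.ext _ _ (Subtype.ext hds.symm)
  · obtain ⟨x, t, hx, hxs, hxt⟩ := exists_chord hs hd hds
    obtain ⟨y, hy⟩ := key ⟨⟨x, mem_sphere_zero_iff_norm.2 hx⟩⟩ (fun h => hxs (by rw [← h]))
    refine ⟨(y, t), ULift.ext _ _ (Subtype.ext ?_)⟩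
    change (diskChord s (q y) t).down.1 = d.down.1
    rw [hy]
    exact hxt

theorem IsSphereCollapse.isQuotientMap_coneMap (hq : IsSphereCollapse q s) :
    Topology.IsQuotientMap (coneMap q s) := by
  have : T2Space (TopCat.disk.{u} (n + 1)) :=
    inferInstanceAs (T2Space (ULift (Metric.closedBall (0 : EuclideanSpace ℝ (Fin (n + 1))) 1)))
  exact (coneMap q s).continuous.isClosedMap.isQuotientMap (coneMap q s).continuous
    hq.surjective_coneMap

/-- The fibre over `s` is exactly the sides and the top; elsewhere `chord_unique` applies. Hence
maps constant on sides and top descend to the disk. -/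
theorem IsSphereCollapse.eq_or_of_coneMap_eq (hq : IsSphereCollapse q s) {z z' : (Fin n → I) × I}
    (h : coneMap q s z = coneMap q s z') :
    z = z' ∨ ((z.1 ∈ Cube.boundary (Fin n) ∨ z.2 = 1) ∧
      (z'.1 ∈ Cube.boundary (Fin n) ∨ z'.2 = 1)) := by
  have hs : ‖s.down.1‖ = 1 := mem_sphere_zero_iff_norm.1 s.down.2
  have hn : ∀ x : TopCat.diskBoundary.{u} (n + 1), ‖x.down.1‖ = 1 := fun x =>
    mem_sphere_zero_iff_norm.1 x.down.2
  have hpt : ∀ w : (Fin n → I) × I, (w.1 ∈ Cube.boundary (Fin n) ∨ w.2 = 1) ↔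
      (coneMap q s w).down.1 = s.down.1 := by
    intro w
    constructor
    · rintro (hw | hw)
      · change (diskChord s (q w.1) w.2).down.1 = _
        rw [hq.boundary _ hw, diskChord_self]
        rfl
      · change (diskChord s (q w.1) w.2).down.1 = _
        rw [hw, diskChord_one]
        rfl
    · intro hw
      by_contra! hc
      refine chord_ne (x := (q w.1).down.1) (t := w.2) (fun h' => hc.1 ?_) (fun h' => hc.2 ?_) hw
      · exact hq.mem_boundary_of_eq (ULift.ext _ _ (Subtype.ext h'))
      · exact Subtype.ext h'
  by_cases hz : z.1 ∈ Cube.boundary (Fin n) ∨ z.2 = 1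
  · exact Or.inr ⟨hz, (hpt z').2 (h ▸ (hpt z).1 hz)⟩
  · have hz' : ¬(z'.1 ∈ Cube.boundary (Fin n) ∨ z'.2 = 1) := fun h' =>
      hz ((hpt z).2 (h.symm ▸ (hpt z').1 h'))
    push Not at hz hz'
    left
    have hne : (q z'.1).down.1 ≠ s.down.1 := fun h' =>
      hz'.1 (hq.mem_boundary_of_eq (ULift.ext _ _ (Subtype.ext h')))
    obtain ⟨h1, h2⟩ := chord_unique hs (hn _) (hn _) hne (fun h' => hz.2 (Subtype.ext h'))
      (fun h' => hz'.2 (Subtype.ext h')) (congrArg (fun d => d.down.1) h)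
    refine Prod.ext (hq.bijOn.injOn hz.1 hz'.1 ?_) (Subtype.ext h2)
    exact ULift.ext _ _ (Subtype.ext h1)

end Cone

/-! ### Extending the section over the cell -/

theorem mainTheorem6 {E' B' E B : Type u} [TopologicalSpace E'] [TopologicalSpace B']
    [TopologicalSpace E] [TopologicalSpace B]
    (P' : PointedFibration E' B') (r' : P'.HomotopicallyTrivial)
    (P : PointedFibration E B) (r : P.HomotopicallyTrivial)
    (f : P'.Hom P) (hf : f.IsSubfibration r' r)
    (n : ℕ) (α : π_ n B' P'.basePt)
    (φ : C(TopCat.diskBoundary.{u} (n + 1), B')) (hφ : RepresentsClass φ α)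
    (hB : IsCellAttachment φ f.base)
    (hsec : Nonempty P'.PointedSection)
    (hα : piZero n P'.fiberPt ∈ PointedFibration.bersteinHilton r' α) :
    Nonempty P.PointedSection := by
  obtain ⟨w, hw⟩ := hα
  obtain ⟨s, q, hq, hs, rfl⟩ := hφ
  obtain ⟨Φ, hΦ⟩ := hB
  have hbase : f.base P'.basePt = P.proj P.pt := by
    rw [← f.map_pt, f.comm]; rfl
  have hΦb : ∀ x, Φ (TopCat.diskBoundaryInclusion (n + 1) x) = f.base (φ x) := fun x =>
    congrArg (fun k => k.hom x) hΦ.w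
  have hΦs : Φ (TopCat.diskBoundaryInclusion (n + 1) s) = P.proj P.pt := by
    rw [hΦb, hs, hbase]
  let τ : C(B', E) := f.total.comp w.toMap
  have hτ : ∀ b, P.proj (τ b) = f.base b := fun b =>
    (f.comm _).trans (congrArg _ (w.proj_toMap b))
  have hτ0 : τ P'.basePt = P.pt := (congrArg _ w.map_basePt).trans f.map_pt
  let g : GenLoop (Fin n) E P.pt := ⟨(τ.comp φ).comp q, fun y hy => by
    simp only [ContinuousMap.comp_apply, hq.boundary y hy, hs, hτ0]⟩
  have hg : r.retr n (Quotient.mk _ g) = piZero n P.fiberPt := by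
    have h1 := hf.isMorphism n (piMap n w.toMap w.map_basePt
      (piMap n φ hs (Quotient.mk _ (⟨q, hq.boundary⟩ : GenLoop (Fin n) _ s))))
    rw [hw] at h1
    refine Eq.trans h1 ?_
    refine congrArg (Quotient.mk _) (GenLoop.ext _ _ fun y => ?_)
    exact f.fiber_fiberPt
  obtain ⟨W, hW, hW0, hWb, hW1⟩ := r.exists_lift_nullHomotopy g hg (Φ.comp (coneMap q s))
    (fun y => by
      change P.proj (τ (φ (q y))) = Φ (diskChord s (q y) 0)
      rw [diskChord_zero, hΦb, hτ])
    (fun y hy t => by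
      change Φ (diskChord s (q y) t) = _
      rw [hq.boundary y hy, diskChord_self, hΦs])
    (fun y => by
      change Φ (diskChord s (q y) 1) = _
      rw [diskChord_one, hΦs])
  have hWpt : ∀ z : (Fin n → I) × I, z.1 ∈ Cube.boundary (Fin n) ∨ z.2 = 1 → W z = P.pt := by
    rintro ⟨y, t⟩ (hy | rfl)
    · exact hWb y hy t
    · exact hW1 y
  have hfac : Function.FactorsThrough W (coneMap q s) := fun z z' h => by
    rcases hq.eq_or_of_coneMap_eq h with rfl | ⟨h1, h2⟩
    · rfl
    · rw [hWpt z h1, hWpt z' h2]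
  let ψ : C(TopCat.disk.{u} (n + 1), E) := hq.isQuotientMap_coneMap.lift W hfac
  have hψ : ∀ z, ψ (coneMap q s z) = W z := fun z =>
    congrArg (fun k => k z) (hq.isQuotientMap_coneMap.lift_comp W hfac)
  have hψΦ : ∀ d, P.proj (ψ d) = Φ d := fun d => by
    obtain ⟨z, rfl⟩ := hq.surjective_coneMap d
    rw [hψ, hW]
    rfl
  have hψb : ∀ x, ψ (TopCat.diskBoundaryInclusion (n + 1) x) = τ (φ x) := fun x => by
    -- For `n = 0` the point `s` is not in the image of `q`, so it is reached as the common end of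
    -- the segments.
    by_cases hx : x = s
    · subst hx
      rw [← diskChord_one x (q fun _ => 0), hs, hτ0]
      exact (hψ (fun _ => 0, 1)).trans (hW1 _)
    · obtain ⟨y, -, rfl⟩ := hq.bijOn.surjOn (show x ∈ ({s}ᶜ : Set _) from hx)
      rw [← diskChord_zero s]
      exact (hψ (y, 0)).trans (hW0 y)
  let S : TopCat.of B ⟶ TopCat.of E := hΦ.desc (TopCat.ofHom ψ) (TopCat.ofHom τ) (by
    ext x
    exact hψb x)
  have hSΦ : ∀ d, S.hom (Φ d) = ψ d := fun d =>
    congrArg (fun k => k.hom d) (hΦ.inl_desc (TopCat.ofHom ψ) (TopCat.ofHom τ) _)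
  have hSf : ∀ b, S.hom (f.base b) = τ b := fun b =>
    congrArg (fun k => k.hom b) (hΦ.inr_desc (TopCat.ofHom ψ) (TopCat.ofHom τ) _)
  have hS : S ≫ TopCat.ofHom P.proj = 𝟙 (TopCat.of B) := by
    refine hΦ.hom_ext ?_ ?_
    · ext d
      exact (congrArg P.proj (hSΦ d)).trans (hψΦ d)
    · ext b
      exact (congrArg P.proj (hSf b)).trans (hτ b)
  refine ⟨⟨S.hom, fun b => congrArg (fun k => k.hom b) hS, ?_⟩⟩
  rw [PointedFibration.basePt, ← hbase, hSf, hτ0]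

end
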